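/- **Messages.** A finite DAG consists of transactions and acks. Each *output* has a value $\ge 0$, an owner key and a unique originating transaction. A *transaction* $t$ has a set of inputs (outputs of earlier transactions, which $t$ *spends*), a set of outputs with the same total value $m_t$ as the inputs, and a validator key, to which all its outputs are delegated. The *genesis* is a transaction without inputs; each of its outputs carries a validator key, and their total value is $M$. An *ack*, issued by a validator, contains at most one reference to an earlier ack of the same validator and a set of references to transactions that it *signs*. A transaction refers to the transactions whose outputs it spends. The messages are issued one after another, each refers only to messages issued before it, and the genesis is the only message without references. For a set $A$ of acks, $\mathrm{past}(A)$ is the set of messages reachable from $A$ by following references (zero or more). **Validators.** A set of keys is controlled by the adversary; nothing is required of these, nor of the issuers of transactions. Every other validator is honest: each of its acks refers to the last ack it issued before (if any), and it never signs two different transactions that spend a common output. **Confirmation**, relative to a set $P$ of messages, is defined inductively. The genesis is confirmed in $P$ if it lies in $P$. A transaction $t$ is confirmed in $P$ if the transactions that output the inputs of $t$ are confirmed in $P$ and there is a set of acks $A_t\subseteq P$ such that (i) some distinct validators $v_1,\dots,v_k$, each signing $t$ by an ack in $\mathrm{past}(A_t)$, have delegated stakes $m_1,\dots,m_k$ in $\mathrm{past}(A_t)$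 with $\sum_i m_i>\frac23M$, and (ii) no transaction $t'\ne t$ in $\mathrm{past}(A_t)$ shares an input with $t$. The stake delegated to $v$ in $\mathrm{past}(A)$ is the total value of the outputs delegated to $v$ of transactions confirmed in $\mathrm{past}(A)$ that are not spent by any transaction (confirmed or not) in $\mathrm{past}(A)$. The theorem holds both for this convention and for the one in which, when the stake behind the acks for $t$ is computed, spending by $t$ itself is disregarded; the same convention is used throughout. **Adversary stake.** Let $m_{t,A}$ be the total value of the inputs of $t$ that are delegated to the adversary. The adversary stake at time $\tau$ is the total value of the genesis outputs delegated to the adversary, plus $m_t-m_{t,A}$ for every non-genesis transaction $t$ with an adversary validator key issued by time $\tau$, minus $m_{t,A}$ for every non-genesis transaction $t$ with an honest validator key that is confirmed in the set of messages issued by time $\tau$. **Conflicts.** Dependence is the reflexive transitive closure of "spends an output of". Two different transactions that spend a common output conflict, and if $t_1,t_2$ conflict, then every transaction that depends on $t_1$ conflicts with every transaction that depends on $t_2$. **Theorem.** If the adversary stake is less than $M/3$ at all times, then the DAG does not contain two conflicting transactions that are both confirmed (in the set of all its messages). -/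

import Mathlib

open scoped NNReal

namespace ABC

/-- A finite DAG of messages (transactions and acks), together with the order in which the messages
were issued. `Out`, `Tx` and `Ack` are the types of the outputs, transactions and acks occurring in
it, `Key` is the type of public keys. Every transaction and ack that occurs carries the required
signatures; by unforgeability the `issuer` of an ack is the validator that really issued it. -/
structure Dag (Key Out Tx Ack : Type*) [Fintype Out] [Fintype Tx] [Fintype Ack] where
  /-- the amount of money of an output -/
  value : Out → ℝ≥0
  /-- the owner key of an output -/
  owner : Out → Key
  /-- the transaction that an output belongs to -/
  origin : Out → Tx
  /-- the genesis transaction -/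
  genesis : Tx
  /-- the outputs that a transaction spends -/
  inputs : Tx → Finset Out
  /-- the validator key of a non-genesis transaction (not used for the genesis) -/
  validator : Tx → Key
  /-- the validator key attached to an output of the genesis (not used for other outputs) -/
  genesisValidator : Out → Key
  /-- the validator that issued an ack -/
  issuer : Ack → Key
  /-- the reference of an ack to a previous ack, if there is one -/
  prev : Ack → Option Ack
  /-- the transactions that an ack signs -/
  signed : Ack → Finset Tx
  /-- the moment at which a message is issued -/
  time : Tx ⊕ Ack → ℕ

namespace Dag

variable {Key Out Tx Ack : Type*} [Fintype Out] [Fintype Tx] [Fintype Ack]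

/-- `G.Ref m m'`: the message `m` contains a reference to the message `m'`. A transaction refers to
the transactions whose outputs it spends. -/
inductive Ref (G : Dag Key Out Tx Ack) : Tx ⊕ Ack → Tx ⊕ Ack → Prop
  | input {t : Tx} {o : Out} : o ∈ G.inputs t → Ref G (Sum.inl t) (Sum.inl (G.origin o))
  | prev {a b : Ack} : G.prev a = some b → Ref G (Sum.inr a) (Sum.inr b)
  | signed {a : Ack} {t : Tx} : t ∈ G.signed a → Ref G (Sum.inr a) (Sum.inl t)

/-- The messages reachable by following references (zero or more) from an ack in `A`. -/
def past (G : Dag Key Out Tx Ack) (A : Set Ack) : Set (Tx ⊕ Ack) :=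
  {m | ∃ a ∈ A, Relation.ReflTransGen G.Ref (Sum.inr a) m}

open Classical in
/-- The total money `M`: the sum of the values of the genesis outputs. -/
noncomputable def totalMoney (G : Dag Key Out Tx Ack) : ℝ :=
  ∑ o with G.origin o = G.genesis, (G.value o : ℝ)

open Classical in
/-- The value `m_t` of a transaction: the sum of the values of its outputs. -/
noncomputable def txValue (G : Dag Key Out Tx Ack) (t : Tx) : ℝ :=
  ∑ o with G.origin o = t, (G.value o : ℝ)

open Classical in
/-- The validator to whom the value of an output is delegated. -/
noncomputable def delegate (G : Dag Key Out Tx Ack) (o : Out) : Key :=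
  if G.origin o = G.genesis then G.genesisValidator o else G.validator (G.origin o)

/-- The messages are well formed and the hash references are acyclic, with the genesis as the only
root. -/
structure WellFormed (G : Dag Key Out Tx Ack) : Prop where
  /-- messages are issued one after the other -/
  time_injective : Function.Injective G.time
  /-- a message refers only to messages issued before it -/
  time_lt_of_ref : ∀ m m', G.Ref m m' → G.time m' < G.time m
  /-- the genesis has no inputs -/
  inputs_genesis : G.inputs G.genesis = ∅
  /-- every message other than the genesis contains a reference -/
  exists_ref : ∀ m, m ≠ Sum.inl G.genesis → ∃ m', G.Ref m m'
  /-- the outputs and the inputs of a transaction have the same total value -/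
  balanced : ∀ t, t ≠ G.genesis → G.txValue t = ∑ o ∈ G.inputs t, (G.value o : ℝ)
  /-- the previous ack that an ack refers to was issued by the same validator -/
  issuer_prev : ∀ a b, G.prev a = some b → G.issuer b = G.issuer a

/-- Two different transactions that spend a common output. -/
def SharesInput (G : Dag Key Out Tx Ack) (t₁ t₂ : Tx) : Prop :=
  t₁ ≠ t₂ ∧ ∃ o, o ∈ G.inputs t₁ ∧ o ∈ G.inputs t₂

/-- The behaviour of honest validators, where `Adv` is the set of keys of the adversary: an ack
refers to the last ack that the validator issued before (so there is a reference unless it is the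
first one), and a validator never signs two transactions that spend a common output. Nothing is
required of the keys in `Adv`, nor of the issuers of transactions. -/
structure HonestFollow (G : Dag Key Out Tx Ack) (Adv : Set Key) : Prop where
  chain : ∀ a b, G.issuer a ∉ Adv → G.issuer b = G.issuer a →
    G.time (Sum.inr b) < G.time (Sum.inr a) →
    ∃ c, G.prev a = some c ∧ G.time (Sum.inr b) ≤ G.time (Sum.inr c)
  no_double_sign : ∀ a b, G.issuer a ∉ Adv → G.issuer b = G.issuer a →
    ∀ t₁ ∈ G.signed a, ∀ t₂ ∈ G.signed b, ¬ G.SharesInput t₁ t₂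

/-- Whether an output that is spent by the very transaction `t` under examination counts as spent
when the stake behind the acks for `t` is computed: `all` means that it does, `others` that only
the transactions different from `t` are taken into account. -/
inductive SpendRule
  | all
  | others

/-- The spenders that are disregarded when `t` is under examination. -/
def SpendRule.ignored : SpendRule → Tx → Set Tx
  | .all, _ => ∅
  | .others, t => {t}

open Classical in
/-- The stake delegated to `v` in the set `P` of messages: the sum of the values of the outputs
delegated to `v` that belong to a transaction in `C` (the set of the transactions confirmed in `P`)
and are not spent by any transaction in `P`, confirmed or not, except possibly those in `X`. -/
noncomputable def delegatedStake (G : Dag Key Out Tx Ack) (C X : Set Tx) (P : Set (Tx ⊕ Ack))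
    (v : Key) : ℝ :=
  ∑ o with G.origin o ∈ C ∧ G.delegate o = v ∧ ∀ s, Sum.inl s ∈ P → o ∈ G.inputs s → s ∈ X,
    (G.value o : ℝ)

/-- The validator `v` signs `t` with an ack in `P`. -/
def Signs (G : Dag Key Out Tx Ack) (P : Set (Tx ⊕ Ack)) (v : Key) (t : Tx) : Prop :=
  ∃ a, Sum.inr a ∈ P ∧ G.issuer a = v ∧ t ∈ G.signed a

/-- `G.Confirmed r P t`: the transaction `t` is confirmed in the set `P` of messages. The set `C` in
the second rule is any set of transactions confirmed in `past A`; as the stake is monotone in `C`,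
it may be taken to be the set of all of them, see `confirmed_iff`. -/
inductive Confirmed (G : Dag Key Out Tx Ack) (r : SpendRule) : Set (Tx ⊕ Ack) → Tx → Prop
  | genesis (P : Set (Tx ⊕ Ack)) : Sum.inl G.genesis ∈ P → Confirmed G r P G.genesis
  | step (P : Set (Tx ⊕ Ack)) (t : Tx) (A : Set Ack) (C : Set Tx) (S : Finset Key) :
      (∀ o ∈ G.inputs t, Confirmed G r P (G.origin o)) →
      (∀ a ∈ A, Sum.inr a ∈ P) →
      (∀ s ∈ C, Confirmed G r (G.past A) s) →
      (∀ v ∈ S, G.Signs (G.past A) v t) →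
      2 / 3 * G.totalMoney < ∑ v ∈ S, G.delegatedStake C (r.ignored t) (G.past A) v →
      (∀ t', Sum.inl t' ∈ G.past A → ¬ G.SharesInput t' t) →
      Confirmed G r P t

/-- Confirmation, spelled out with the stake computed from all the confirmed transactions. -/
theorem confirmed_iff (G : Dag Key Out Tx Ack) (r : SpendRule) (P : Set (Tx ⊕ Ack)) (t : Tx) :
    G.Confirmed r P t ↔
      (t = G.genesis ∧ Sum.inl G.genesis ∈ P) ∨
      ((∀ o ∈ G.inputs t, G.Confirmed r P (G.origin o)) ∧
        ∃ A : Set Ack, (∀ a ∈ A, Sum.inr a ∈ P) ∧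
          (∃ S : Finset Key, (∀ v ∈ S, G.Signs (G.past A) v t) ∧
            2 / 3 * G.totalMoney < ∑ v ∈ S, G.delegatedStake {s | G.Confirmed r (G.past A) s}
              (r.ignored t) (G.past A) v) ∧
          ∀ t', Sum.inl t' ∈ G.past A → ¬ G.SharesInput t' t) := by
  classical
  constructor
  · intro h
    cases h with
    | genesis _ h => exact Or.inl ⟨rfl, h⟩
    | step _ _ A C S h1 h2 h3 h4 h5 h6 =>
      refine Or.inr ⟨h1, A, h2, ⟨S, h4, lt_of_lt_of_le h5 ?_⟩, h6⟩
      refine Finset.sum_le_sum fun v _ => ?_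
      refine Finset.sum_le_sum_of_subset_of_nonneg ?_ fun o _ _ => (G.value o).coe_nonneg
      intro o ho
      simp only [Finset.mem_filter] at ho ⊢
      exact ⟨ho.1, h3 _ ho.2.1, ho.2.2⟩
  · rintro (⟨rfl, h⟩ | ⟨h1, A, h2, ⟨S, h4, h5⟩, h6⟩)
    · exact Confirmed.genesis P h
    · exact Confirmed.step P t A _ S h1 h2 (fun _ hs => hs) h4 h5 h6

/-- The messages issued up to the moment `τ`. -/
def issuedBy (G : Dag Key Out Tx Ack) (τ : ℕ) : Set (Tx ⊕ Ack) :=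
  {m | G.time m ≤ τ}

open Classical in
/-- `m_{t,A}`: the total value of the inputs of `t` that are delegated to the adversary. -/
noncomputable def advInputs (G : Dag Key Out Tx Ack) (Adv : Set Key) (t : Tx) : ℝ :=
  ∑ o ∈ G.inputs t with G.delegate o ∈ Adv, (G.value o : ℝ)

open Classical in
/-- The amount counted as delegated to the adversary at the moment `τ`: start with the genesis
outputs delegated to the adversary, add `m_t - m_{t,A}` for each transaction `t` delegated to the
adversary that has been issued, and subtract `m_{t,A}` for each transaction `t` delegated to an
honest agent that has become confirmed. -/
noncomputable def adversaryStake (G : Dag Key Out Tx Ack) (r : SpendRule) (Adv : Set Key)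
    (τ : ℕ) : ℝ :=
  (∑ o with G.origin o = G.genesis ∧ G.delegate o ∈ Adv, (G.value o : ℝ))
    + (∑ t with t ≠ G.genesis ∧ G.validator t ∈ Adv ∧ Sum.inl t ∈ G.issuedBy τ,
        (G.txValue t - G.advInputs Adv t))
    - ∑ t with t ≠ G.genesis ∧ G.validator t ∉ Adv ∧ G.Confirmed r (G.issuedBy τ) t,
        G.advInputs Adv t

/-- `t'` depends on `t`: the reflexive transitive closure of spending an output. -/
def Depends (G : Dag Key Out Tx Ack) (t' t : Tx) : Prop :=
  Relation.ReflTransGen (fun u w => ∃ o ∈ G.inputs u, G.origin o = w) t' t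

/-- Transactions that spend a common output conflict, and so do any transactions that depend on the
two members of a conflicting pair. -/
inductive Conflicts (G : Dag Key Out Tx Ack) : Tx → Tx → Prop
  | spend {t₁ t₂ : Tx} : G.SharesInput t₁ t₂ → Conflicts G t₁ t₂
  | depends {s₁ s₂ t₁ t₂ : Tx} : Conflicts G s₁ s₂ → G.Depends t₁ s₁ → G.Depends t₂ s₂ →
      Conflicts G t₁ t₂

end Dag

end ABC

/-!
Call a set `A` of acks a certificate of `t` if it meets the stake and no-conflict conditions of the
confirmation rule. The claim is that of two certified transactions one lies in the past of the
certificate of the other; since a past that certifies a transaction contains nothing conflicting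
with it, this rules out conflicts.

In a minimal counterexample, the transactions that either certificate takes to be confirmed lie in
both pasts and, by minimality, form a ledger without double spending. The outputs backing the two
transactions are unspent in it, so by conservation of money their total value is at most `M`, and
the outputs that back both transactions are worth more than `M / 3`. No honest validator has signed
both transactions, because its later ack would know both. So the common outputs are delegated to the
adversary, and at the moment when the last common confirmed transaction was issued the adversary
stake was at least their value.
-/

namespace ABC

open Relation

theorem pair_induction {α : Type*} [Preorder α] [WellFoundedLT α] {p : α → α → Prop}
    (h : ∀ a b, (∀ x y, (x < a ∨ x < b) → (y < a ∨ y < b) → p x y) →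
      (∀ x < a, p x b) → (∀ y < b, p a y) → p a b) (a b : α) : p a b := by
  suffices H : ∀ s : Multiset α, ∀ a b, s = {a, b} → p a b from H _ a b rfl
  intro s
  induction s using (Multiset.wellFounded_isDershowitzMannaLT (α := α)).induction with
  | _ s ih =>
    rintro a b rfl
    refine h a b (fun x y hx hy => ih {x, y} ?_ x y rfl) (fun x hx => ih {x, b} ?_ x b rfl)
      (fun y hy => ih {a, y} ?_ a y rfl)
    · refine ⟨0, {x, y}, {a, b}, by simp, by simp, by simp, fun z hz => ?_⟩
      obtain rfl | rfl : z = x ∨ z = y := by simpa using hz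
      · simpa using hx
      · simpa using hy
    · exact ⟨{b}, {x}, {a}, by simp, Multiset.pair_comm x b, Multiset.pair_comm a b,
        by simpa using hx⟩
    · exact ⟨{a}, {y}, {b}, by simp, rfl, rfl, by simpa using hy⟩

namespace Dag

variable {Key Out Tx Ack : Type*} [Fintype Out] [Fintype Tx] [Fintype Ack]
  {G : Dag Key Out Tx Ack} {r : SpendRule} {Adv : Set Key}

theorem sum_value_mono {E F : Finset Out} (h : E ⊆ F) :
    ∑ o ∈ E, (G.value o : ℝ) ≤ ∑ o ∈ F, (G.value o : ℝ) :=
  Finset.sum_le_sum_of_subset_of_nonneg h fun o _ _ => (G.value o).coe_nonneg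

theorem totalMoney_nonneg : 0 ≤ G.totalMoney :=
  Finset.sum_nonneg fun o _ => (G.value o).coe_nonneg

theorem SharesInput.symm {s t : Tx} (h : G.SharesInput s t) : G.SharesInput t s :=
  let ⟨hne, o, hs, ht⟩ := h
  ⟨hne.symm, o, ht, hs⟩

theorem WellFormed.ne_genesis_of_mem_inputs (hG : G.WellFormed) {t : Tx} {o : Out}
    (ho : o ∈ G.inputs t) : t ≠ G.genesis := by
  rintro rfl
  simp [hG.inputs_genesis] at ho

theorem SharesInput.ne_genesis (hG : G.WellFormed) {s t : Tx} (h : G.SharesInput s t) :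
    s ≠ G.genesis :=
  let ⟨_, _, hs, _⟩ := h
  hG.ne_genesis_of_mem_inputs hs

/-! ### Pasts -/

/-- A set of messages is closed under following references; this is the common property of
`past A` and `issuedBy τ`. -/
def RefClosed (G : Dag Key Out Tx Ack) (P : Set (Tx ⊕ Ack)) : Prop :=
  ∀ ⦃m m'⦄, m ∈ P → G.Ref m m' → m' ∈ P

theorem RefClosed.mem_of_reach {P : Set (Tx ⊕ Ack)} (hP : G.RefClosed P) {m m' : Tx ⊕ Ack}
    (hm : m ∈ P) (h : ReflTransGen G.Ref m m') : m' ∈ P := by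
  induction h with
  | refl => exact hm
  | tail _ h ih => exact hP ih h

theorem RefClosed.past_subset {P : Set (Tx ⊕ Ack)} (hP : G.RefClosed P) {A : Set Ack}
    (hA : ∀ a ∈ A, Sum.inr a ∈ P) : G.past A ⊆ P :=
  fun _ ⟨a, ha, h⟩ => hP.mem_of_reach (hA a ha) h

theorem refClosed_past (A : Set Ack) : G.RefClosed (G.past A) :=
  fun _ _ ⟨a, ha, h⟩ hr => ⟨a, ha, h.tail hr⟩

theorem Signs.mem_past {A : Set Ack} {v : Key} {t : Tx} (h : G.Signs (G.past A) v t) :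
    Sum.inl t ∈ G.past A :=
  let ⟨_, ha, _, ht⟩ := h
  refClosed_past A ha (.signed ht)

namespace WellFormed

theorem refClosed_issuedBy (hG : G.WellFormed) (τ : ℕ) : G.RefClosed (G.issuedBy τ) :=
  fun _ _ hm h => (hG.time_lt_of_ref _ _ h).le.trans hm

theorem time_le_of_reach (hG : G.WellFormed) {m m' : Tx ⊕ Ack} (h : ReflTransGen G.Ref m m') :
    G.time m' ≤ G.time m :=
  (hG.refClosed_issuedBy _).mem_of_reach (le_refl (G.time m)) h

theorem reach_genesis (hG : G.WellFormed) (m : Tx ⊕ Ack) :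
    ReflTransGen G.Ref m (Sum.inl G.genesis) := by
  induction hn : G.time m using Nat.strong_induction_on generalizing m with
  | _ n ih =>
    by_cases hm : m = Sum.inl G.genesis
    · rw [hm]
    · obtain ⟨m', h⟩ := hG.exists_ref m hm
      exact (ih _ (hn ▸ hG.time_lt_of_ref _ _ h) m' rfl).head h

theorem time_lt_of_mem_past (hG : G.WellFormed) {A : Set Ack} {τ : ℕ}
    (hA : G.past A ⊆ G.issuedBy τ) {t : Tx} (ht : Sum.inl t ∈ G.past A) :
    G.time (Sum.inl t) < τ := by
  obtain ⟨a, ha, h⟩ := ht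
  have hlt : G.time (Sum.inl t) < G.time (Sum.inr a) :=
    (hG.time_le_of_reach h).lt_of_ne fun he => Sum.inl_ne_inr (hG.time_injective he)
  exact hlt.trans_le (hA ⟨a, ha, .refl⟩)

end WellFormed

/-- Every ack of a validator outside `Adv` has all earlier acks of that validator in its past. -/
def AcksChained (G : Dag Key Out Tx Ack) (Adv : Set Key) : Prop :=
  ∀ ⦃a b⦄, G.issuer a ∉ Adv → G.issuer b = G.issuer a →
    G.time (Sum.inr b) ≤ G.time (Sum.inr a) → ReflTransGen G.Ref (Sum.inr a) (Sum.inr b)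

theorem HonestFollow.acksChained (hH : G.HonestFollow Adv) (hG : G.WellFormed) :
    G.AcksChained Adv := by
  intro a b ha hb hab
  induction hn : G.time (Sum.inr a) using Nat.strong_induction_on generalizing a with
  | _ n ih =>
    rcases hab.eq_or_lt with h | h
    · rw [hG.time_injective h]
    · obtain ⟨c, hc, hbc⟩ := hH.chain a b ha hb h
      have hi := hG.issuer_prev a c hc
      exact (ih _ (hn ▸ hG.time_lt_of_ref _ _ (.prev hc)) (hi ▸ ha) (hb.trans hi.symm) hbc
        rfl).head (.prev hc)

theorem AcksChained.mem_past_or_mem_past_of_signs (hH : G.AcksChained Adv) {A₁ A₂ : Set Ack}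
    {t₁ t₂ : Tx} {v : Key} (hv : v ∉ Adv) (h₁ : G.Signs (G.past A₁) v t₁)
    (h₂ : G.Signs (G.past A₂) v t₂) : Sum.inl t₁ ∈ G.past A₂ ∨ Sum.inl t₂ ∈ G.past A₁ := by
  obtain ⟨a, ha, rfl, hat⟩ := h₁
  obtain ⟨b, hb, hba, hbt⟩ := h₂
  rcases le_total (G.time (Sum.inr a)) (G.time (Sum.inr b)) with h | h
  · exact Or.inl ((refClosed_past A₂).mem_of_reach hb
      ((hH (hba ▸ hv) hba.symm h).tail (.signed hat)))
  · exact Or.inr ((refClosed_past A₁).mem_of_reach ha ((hH hv hba h).tail (.signed hbt)))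

/-! ### Conservation of money -/

/-- A set of transactions that contains the genesis and the origins of the inputs of its members,
and in which no output is spent twice. -/
structure IsLedger (G : Dag Key Out Tx Ack) (D : Set Tx) : Prop where
  genesis_mem : G.genesis ∈ D
  origin_mem : ∀ t ∈ D, ∀ o ∈ G.inputs t, G.origin o ∈ D
  not_sharesInput : ∀ s ∈ D, ∀ t ∈ D, ¬ G.SharesInput s t

open Classical in
/-- The outputs of the members of `D` that no member of `D` spends. -/
noncomputable def unspent (G : Dag Key Out Tx Ack) (D : Set Tx) : Finset Out :=
  {o | G.origin o ∈ D ∧ ∀ s ∈ D, o ∉ G.inputs s}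

theorem mem_unspent {D : Set Tx} {o : Out} :
    o ∈ G.unspent D ↔ G.origin o ∈ D ∧ ∀ s ∈ D, o ∉ G.inputs s := by
  simp [unspent]

open Classical in
/-- The total value of the outputs of `t` that are delegated to the adversary, the counterpart of
`advInputs`. -/
noncomputable def advOutputs (G : Dag Key Out Tx Ack) (Adv : Set Key) (t : Tx) : ℝ :=
  ∑ o with G.origin o = t ∧ G.delegate o ∈ Adv, (G.value o : ℝ)

theorem advInputs_nonneg (t : Tx) : 0 ≤ G.advInputs Adv t := by
  classical
  exact Finset.sum_nonneg fun o _ => (G.value o).coe_nonneg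

theorem WellFormed.advInputs_le_txValue (hG : G.WellFormed) {t : Tx} (ht : t ≠ G.genesis) :
    G.advInputs Adv t ≤ G.txValue t := by
  classical
  rw [hG.balanced t ht]
  exact sum_value_mono (Finset.filter_subset _ _)

theorem delegate_of_origin_ne_genesis {o : Out} (ho : G.origin o ≠ G.genesis) :
    G.delegate o = G.validator (G.origin o) :=
  if_neg ho

theorem advOutputs_of_validator_mem {t : Tx} (ht : t ≠ G.genesis) (hv : G.validator t ∈ Adv) :
    G.advOutputs Adv t = G.txValue t := by
  classical
  refine Finset.sum_congr (Finset.filter_congr fun o _ => and_iff_left_of_imp ?_) fun _ _ => rfl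
  rintro rfl
  rwa [delegate_of_origin_ne_genesis ht]

theorem advOutputs_of_validator_notMem {t : Tx} (ht : t ≠ G.genesis) (hv : G.validator t ∉ Adv) :
    G.advOutputs Adv t = 0 := by
  classical
  refine Finset.sum_eq_zero fun o ho => absurd ?_ hv
  obtain ⟨rfl, hdel⟩ := (Finset.mem_filter.1 ho).2
  rwa [delegate_of_origin_ne_genesis ht] at hdel

namespace IsLedger

open Classical in
theorem sum_unspent {M : Type*} [AddCommGroup M] {D : Set Tx} (hD : G.IsLedger D) (f : Out → M) :
    ∑ o ∈ G.unspent D, f o =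
      ∑ t with t ∈ D, (∑ o with G.origin o = t, f o - ∑ o ∈ G.inputs t, f o) := by
  set T : Finset Tx := {t | t ∈ D}
  have hT : ∀ t, t ∈ T ↔ t ∈ D := by simp [T]
  have hcreated : ∑ o ∈ T.biUnion fun t => {o | G.origin o = t}, f o =
      ∑ t ∈ T, ∑ o with G.origin o = t, f o := by
    refine Finset.sum_biUnion fun s _ t _ hst => Finset.disjoint_left.2 fun o hs ht => hst ?_
    exact (Finset.mem_filter.1 hs).2.symm.trans (Finset.mem_filter.1 ht).2
  have hspent : ∑ o ∈ T.biUnion G.inputs, f o = ∑ t ∈ T, ∑ o ∈ G.inputs t, f o := by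
    refine Finset.sum_biUnion fun s hs t ht hst => Finset.disjoint_left.2 fun o hos hot => ?_
    exact hD.not_sharesInput s ((hT s).1 hs) t ((hT t).1 ht) ⟨hst, o, hos, hot⟩
  have hsub : T.biUnion G.inputs ⊆ T.biUnion fun t => {o | G.origin o = t} := by
    intro o ho
    obtain ⟨s, hs, hos⟩ := Finset.mem_biUnion.1 ho
    simpa [hT] using hD.origin_mem s ((hT s).1 hs) o hos
  rw [Finset.sum_sub_distrib, ← hcreated, ← hspent, ← Finset.sum_sdiff_eq_sub hsub]
  congr 1
  ext o
  simp [mem_unspent, hT]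

theorem sum_value_unspent {D : Set Tx} (hD : G.IsLedger D) (hG : G.WellFormed) :
    ∑ o ∈ G.unspent D, (G.value o : ℝ) = G.totalMoney := by
  classical
  rw [hD.sum_unspent, Finset.sum_eq_single_of_mem G.genesis (by simpa using hD.genesis_mem)]
  · simp [hG.inputs_genesis, totalMoney]
  · intro t _ ht
    rw [← hG.balanced t ht]
    exact sub_self _

open Classical in
theorem sum_value_unspent_adversary {D : Set Tx} (hD : G.IsLedger D) :
    ∑ o ∈ G.unspent D with G.delegate o ∈ Adv, (G.value o : ℝ) =
      ∑ t with t ∈ D, (G.advOutputs Adv t - G.advInputs Adv t) := by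
  rw [Finset.sum_filter, hD.sum_unspent]
  simp only [← Finset.sum_filter, Finset.filter_filter, advOutputs, advInputs]

open Classical in
theorem sum_value_unspent_adversary_le {D : Set Tx} (hD : G.IsLedger D) (hG : G.WellFormed) {τ : ℕ}
    (hτ : ∀ t ∈ D, Sum.inl t ∈ G.issuedBy τ) (hc : ∀ t, G.Confirmed r (G.issuedBy τ) t → t ∈ D) :
    ∑ o ∈ G.unspent D with G.delegate o ∈ Adv, (G.value o : ℝ) ≤ G.adversaryStake r Adv τ := by
  have hgenesis : G.advOutputs Adv G.genesis - G.advInputs Adv G.genesis =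
      ∑ o with G.origin o = G.genesis ∧ G.delegate o ∈ Adv, (G.value o : ℝ) := by
    simp [advInputs, advOutputs, hG.inputs_genesis]
  have hadv : ∑ t with (t ∈ D ∧ t ≠ G.genesis) ∧ G.validator t ∈ Adv,
        (G.advOutputs Adv t - G.advInputs Adv t) ≤
      ∑ t with t ≠ G.genesis ∧ G.validator t ∈ Adv ∧ Sum.inl t ∈ G.issuedBy τ,
        (G.txValue t - G.advInputs Adv t) := by
    refine (Finset.sum_congr rfl fun t ht => ?_).trans_le
      (Finset.sum_le_sum_of_subset_of_nonneg ?_ fun t ht _ => ?_)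
    · simp only [Finset.mem_filter] at ht
      rw [advOutputs_of_validator_mem ht.2.1.2 ht.2.2]
    · exact Finset.monotone_filter_right _ fun t _ ht => ⟨ht.1.2, ht.2, hτ t ht.1.1⟩
    · simp only [Finset.mem_filter] at ht
      exact sub_nonneg.2 (hG.advInputs_le_txValue ht.2.1)
  have hhonest : ∑ t with (t ∈ D ∧ t ≠ G.genesis) ∧ G.validator t ∉ Adv,
        (G.advOutputs Adv t - G.advInputs Adv t) ≤
      -∑ t with t ≠ G.genesis ∧ G.validator t ∉ Adv ∧ G.Confirmed r (G.issuedBy τ) t,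
        G.advInputs Adv t := by
    rw [le_neg, ← Finset.sum_neg_distrib]
    refine (Finset.sum_le_sum_of_subset_of_nonneg ?_ fun t _ _ => advInputs_nonneg t).trans_eq
      (Finset.sum_congr rfl fun t ht => ?_)
    · exact Finset.monotone_filter_right _ fun t _ ht => ⟨⟨hc t ht.2.2, ht.1⟩, ht.2.1⟩
    · simp only [Finset.mem_filter] at ht
      rw [advOutputs_of_validator_notMem ht.2.1.2 ht.2.2, zero_sub, neg_neg]
  rw [hD.sum_value_unspent_adversary, ← Finset.add_sum_erase _ _ (by simpa using hD.genesis_mem),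
    hgenesis, adversaryStake, add_sub_assoc, sub_eq_add_neg,
    ← Finset.sum_filter_add_sum_filter_not _ (fun t => G.validator t ∈ Adv)]
  simp only [← Finset.filter_ne', Finset.filter_filter]
  gcongr

end IsLedger

/-! ### Certificates -/

open Classical in
/-- The outputs whose stake counts as acking `t` in `past A`, where `C` is the set of the
transactions taken to be confirmed in `past A`. Spending by `t` itself is disregarded: this is the
weaker of the two conventions, so what is proved from it holds for both. -/
noncomputable def backing (G : Dag Key Out Tx Ack) (C : Set Tx) (A : Set Ack) (t : Tx) :
    Finset Out :=
  {o | G.origin o ∈ C ∧ G.Signs (G.past A) (G.delegate o) t ∧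
    ∀ s, Sum.inl s ∈ G.past A → o ∈ G.inputs s → s = t}

theorem mem_backing {C : Set Tx} {A : Set Ack} {t : Tx} {o : Out} :
    o ∈ G.backing C A t ↔ G.origin o ∈ C ∧ G.Signs (G.past A) (G.delegate o) t ∧
      ∀ s, Sum.inl s ∈ G.past A → o ∈ G.inputs s → s = t := by
  simp [backing]

theorem SpendRule.eq_of_mem_ignored {Tx : Type*} {r : SpendRule} {s t : Tx}
    (h : s ∈ r.ignored t) : s = t := by
  cases r with
  | all => exact h.elim
  | others => exact h

theorem sum_delegatedStake_le_sum_backing {C C' : Set Tx} (hC : C ⊆ C') {A : Set Ack} {t : Tx}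
    {S : Finset Key} (hS : ∀ v ∈ S, G.Signs (G.past A) v t) :
    ∑ v ∈ S, G.delegatedStake C (r.ignored t) (G.past A) v ≤
      ∑ o ∈ G.backing C' A t, (G.value o : ℝ) := by
  classical
  simp only [delegatedStake]
  rw [← Finset.sum_biUnion]
  · refine sum_value_mono fun o ho => mem_backing.2 ?_
    obtain ⟨v, hv, ho⟩ := Finset.mem_biUnion.1 ho
    obtain ⟨-, hoC, rfl, hspent⟩ := Finset.mem_filter.1 ho
    exact ⟨hC hoC, hS _ hv, fun s hs hos => SpendRule.eq_of_mem_ignored (hspent s hs hos)⟩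
  · refine fun v _ w _ hvw => Finset.disjoint_left.2 fun o hv hw => hvw ?_
    exact (Finset.mem_filter.1 hv).2.2.1.symm.trans (Finset.mem_filter.1 hw).2.2.1

/-- The acks `A` confirm `t`, provided that the inputs of `t` are confirmed, where `C` is the set of
the transactions taken to be confirmed in `past A`. -/
structure Certifies (G : Dag Key Out Tx Ack) (C : Set Tx) (A : Set Ack) (t : Tx) : Prop where
  lt_sum_backing : 2 / 3 * G.totalMoney < ∑ o ∈ G.backing C A t, (G.value o : ℝ)
  not_sharesInput : ∀ t', Sum.inl t' ∈ G.past A → ¬ G.SharesInput t' t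

theorem Certifies.mem_past {C : Set Tx} {A : Set Ack} {t : Tx} (h : G.Certifies C A t) :
    Sum.inl t ∈ G.past A := by
  have hpos : 0 < ∑ o ∈ G.backing C A t, (G.value o : ℝ) :=
    (mul_nonneg (by norm_num) totalMoney_nonneg).trans_lt h.lt_sum_backing
  obtain ⟨o, ho⟩ := Finset.nonempty_of_sum_ne_zero hpos.ne'
  exact (mem_backing.1 ho).2.1.mem_past

/-- The transactions confirmed in `P` by at most `n` nested applications of the confirmation rule,
in the convention of `backing`. The nesting depth is what makes induction possible: a certificate
and the certificates of the transactions that it takes to be confirmed may have the same past. -/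
def stage (G : Dag Key Out Tx Ack) : ℕ → Set (Tx ⊕ Ack) → Set Tx
  | 0, P => {t | t = G.genesis ∧ Sum.inl t ∈ P}
  | n + 1, P => stage G n P ∪ {t | (∀ o ∈ G.inputs t, G.origin o ∈ stage G n P) ∧
      ∃ A : Set Ack, (∀ a ∈ A, Sum.inr a ∈ P) ∧ G.Certifies (stage G n (G.past A)) A t}

theorem stage_mono {k n : ℕ} (h : k ≤ n) (P : Set (Tx ⊕ Ack)) : G.stage k P ⊆ G.stage n P :=
  monotone_nat_of_le_succ (f := fun n => G.stage n P) (fun _ => Set.subset_union_left) h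

theorem WellFormed.genesis_mem_stage (hG : G.WellFormed) {P : Set (Tx ⊕ Ack)} (hP : G.RefClosed P)
    {m : Tx ⊕ Ack} (hm : m ∈ P) (n : ℕ) : G.genesis ∈ G.stage n P :=
  stage_mono n.zero_le P ⟨rfl, hP.mem_of_reach hm (hG.reach_genesis m)⟩

theorem WellFormed.origin_mem_stage (hG : G.WellFormed) {n : ℕ} {P : Set (Tx ⊕ Ack)} {t : Tx}
    (ht : t ∈ G.stage n P) {o : Out} (ho : o ∈ G.inputs t) : G.origin o ∈ G.stage n P := by
  induction n with
  | zero => exact absurd ht.1 (hG.ne_genesis_of_mem_inputs ho)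
  | succ n ih => exact Or.inl (ht.elim ih fun h => h.1 o ho)

theorem RefClosed.mem_of_mem_stage {P : Set (Tx ⊕ Ack)} (hP : G.RefClosed P) {n : ℕ} {t : Tx}
    (ht : t ∈ G.stage n P) : Sum.inl t ∈ P := by
  induction n with
  | zero => exact ht.2
  | succ n ih => exact ht.elim ih fun ⟨_, _, hA, h⟩ => hP.past_subset hA h.mem_past

theorem exists_certifies_of_mem_stage {n : ℕ} {P : Set (Tx ⊕ Ack)} {t : Tx}
    (ht : t ∈ G.stage n P) (hg : t ≠ G.genesis) : ∃ k < n, ∃ A : Set Ack,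
      (∀ a ∈ A, Sum.inr a ∈ P) ∧ G.Certifies (G.stage k (G.past A)) A t := by
  induction n with
  | zero => exact absurd ht.1 hg
  | succ n ih =>
    rcases ht with ht | ⟨-, A, hA, h⟩
    · obtain ⟨k, hk, hA⟩ := ih ht
      exact ⟨k, hk.trans n.lt_succ_self, hA⟩
    · exact ⟨n, n.lt_succ_self, A, hA, h⟩

theorem exists_subset_stage {C : Set Tx} {P : Set (Tx ⊕ Ack)}
    (h : ∀ t ∈ C, ∃ n, t ∈ G.stage n P) : ∃ n, C ⊆ G.stage n P := by
  choose! f hf using h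
  exact ⟨Finset.univ.sup f, fun t ht => stage_mono (Finset.le_sup (Finset.mem_univ t)) P (hf t ht)⟩

theorem Confirmed.exists_mem_stage {P : Set (Tx ⊕ Ack)} {t : Tx} (h : G.Confirmed r P t) :
    ∃ n, t ∈ G.stage n P := by
  induction h with
  | genesis P h => exact ⟨0, rfl, h⟩
  | step P t A C S _ hA _ hS hM hX ih_origin ih_known =>
    obtain ⟨n, hn⟩ := exists_subset_stage (C := {s | ∃ o ∈ G.inputs t, G.origin o = s})
      (fun s ⟨o, ho, e⟩ => e ▸ ih_origin o ho)
    obtain ⟨k, hk⟩ := exists_subset_stage ih_known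
    refine ⟨max n k + 1, Or.inr ⟨fun o ho => ?_, A, hA, ?_, hX⟩⟩
    · exact stage_mono (le_max_left n k) P (hn ⟨o, ho, rfl⟩)
    · exact hM.trans_le (sum_delegatedStake_le_sum_backing
        (hk.trans (stage_mono (le_max_right n k) _)) hS)

/-- The transactions that the acks `A` take to be confirmed when they serve as a certificate of
rank `x`. -/
def basis (G : Dag Key Out Tx Ack) (x : ℕ ×ₗ ℕ) (A : Set Ack) : Set Tx :=
  G.stage (ofLex x).2 (G.past A)

/-- The acks `A` are a certificate of `t` of rank `x`: they are issued by the moment `x.1` and rely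
on transactions confirmed by at most `x.2` nested applications of the confirmation rule. -/
structure CertifiesAt (G : Dag Key Out Tx Ack) (x : ℕ ×ₗ ℕ) (A : Set Ack) (t : Tx) : Prop where
  past_subset : G.past A ⊆ G.issuedBy (ofLex x).1
  certifies : G.Certifies (G.basis x A) A t

theorem RefClosed.exists_certifiesAt {P : Set (Tx ⊕ Ack)} (hP : G.RefClosed P) {τ : ℕ}
    (hτ : P ⊆ G.issuedBy τ) {n : ℕ} {t : Tx} (ht : t ∈ G.stage n P) (hg : t ≠ G.genesis) :
    ∃ k < n, ∃ A, G.past A ⊆ P ∧ G.CertifiesAt (toLex (τ, k)) A t := by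
  obtain ⟨k, hk, A, hA, h⟩ := exists_certifies_of_mem_stage ht hg
  have hAP := hP.past_subset hA
  exact ⟨k, hk, A, hAP, hAP.trans hτ, h⟩

theorem exists_certifiesAt_of_mem_basis {x : ℕ ×ₗ ℕ} {A : Set Ack} {s : Tx}
    (hA : G.past A ⊆ G.issuedBy (ofLex x).1) (hs : s ∈ G.basis x A) (hg : s ≠ G.genesis) :
    ∃ z < x, ∃ B, G.past B ⊆ G.past A ∧ G.CertifiesAt z B s := by
  obtain ⟨k, hk, hB⟩ := (refClosed_past A).exists_certifiesAt hA hs hg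
  exact ⟨_, Prod.Lex.right _ hk, hB⟩

theorem Confirmed.exists_certifiesAt {P : Set (Tx ⊕ Ack)} {t : Tx} (h : G.Confirmed r P t)
    (hg : t ≠ G.genesis) : ∃ x A, G.CertifiesAt x A t := by
  obtain ⟨n, hn⟩ := h.exists_mem_stage
  obtain ⟨k, -, A, -, hA⟩ := exists_certifies_of_mem_stage hn hg
  refine ⟨toLex (Finset.univ.sup G.time, k), A, fun m _ => ?_, hA⟩
  exact Finset.le_sup (f := G.time) (Finset.mem_univ m)

/-! ### Any two certificates are compatible -/

/-- Of any two transactions with certificates of ranks `x` and `y`, one is known to the certificate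
of the other. -/
def Compatible (G : Dag Key Out Tx Ack) (x y : ℕ ×ₗ ℕ) : Prop :=
  ∀ ⦃A₁ A₂ t₁ t₂⦄, G.CertifiesAt x A₁ t₁ → G.CertifiesAt y A₂ t₂ →
    Sum.inl t₁ ∈ G.past A₂ ∨ Sum.inl t₂ ∈ G.past A₁

theorem Compatible.symm {x y : ℕ ×ₗ ℕ} (h : G.Compatible x y) : G.Compatible y x :=
  fun _ _ _ _ h₁ h₂ => (h h₂ h₁).symm

theorem Compatible.not_sharesInput {x y : ℕ ×ₗ ℕ} (h : G.Compatible x y) {A₁ A₂ : Set Ack}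
    {t₁ t₂ : Tx} (h₁ : G.CertifiesAt x A₁ t₁) (h₂ : G.CertifiesAt y A₂ t₂) :
    ¬ G.SharesInput t₁ t₂ := fun hs =>
  (h h₁ h₂).elim (fun hm => h₂.certifies.not_sharesInput _ hm hs)
    fun hm => h₁.certifies.not_sharesInput _ hm hs.symm

/-- Two incompatible certificates of ranks `x` and `y`, where any two certificates whose pair of
ranks is smaller, in the sense of `pair_induction`, are compatible. -/
structure MinimalFork (G : Dag Key Out Tx Ack) (x y : ℕ ×ₗ ℕ) (A₁ A₂ : Set Ack) (t₁ t₂ : Tx) :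
    Prop where
  left : G.CertifiesAt x A₁ t₁
  right : G.CertifiesAt y A₂ t₂
  left_notMem : Sum.inl t₁ ∉ G.past A₂
  right_notMem : Sum.inl t₂ ∉ G.past A₁
  compatible : ∀ z z', (z < x ∨ z < y) → (z' < x ∨ z' < y) → G.Compatible z z'
  compatible_of_lt_left : ∀ z < x, G.Compatible z y
  compatible_of_lt_right : ∀ z < y, G.Compatible x z

namespace MinimalFork

variable {x y : ℕ ×ₗ ℕ} {A₁ A₂ : Set Ack} {t₁ t₂ : Tx}

theorem symm (h : G.MinimalFork x y A₁ A₂ t₁ t₂) : G.MinimalFork y x A₂ A₁ t₂ t₁ where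
  left := h.right
  right := h.left
  left_notMem := h.right_notMem
  right_notMem := h.left_notMem
  compatible z z' hz hz' := h.compatible z z' hz.symm hz'.symm
  compatible_of_lt_left z hz := (h.compatible_of_lt_right z hz).symm
  compatible_of_lt_right z hz := (h.compatible_of_lt_left z hz).symm

theorem genesis_mem_basis (h : G.MinimalFork x y A₁ A₂ t₁ t₂) (hG : G.WellFormed) :
    G.genesis ∈ G.basis x A₁ :=
  hG.genesis_mem_stage (refClosed_past A₁) h.left.certifies.mem_past _

theorem mem_past_of_mem_basis (h : G.MinimalFork x y A₁ A₂ t₁ t₂) (hG : G.WellFormed) {s : Tx}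
    (hs : s ∈ G.basis x A₁) : Sum.inl s ∈ G.past A₁ ∧ Sum.inl s ∈ G.past A₂ := by
  refine ⟨(refClosed_past A₁).mem_of_mem_stage hs, ?_⟩
  by_cases hg : s = G.genesis
  · exact hg ▸ (refClosed_past A₂).mem_of_reach h.right.certifies.mem_past (hG.reach_genesis _)
  · obtain ⟨z, hz, B, hB, hc⟩ := exists_certifiesAt_of_mem_basis h.left.past_subset hs hg
    exact (h.compatible_of_lt_left z hz hc h.right).resolve_right fun hm => h.right_notMem (hB hm)

theorem notMem_inputs_of_mem_backing (h : G.MinimalFork x y A₁ A₂ t₁ t₂) {C : Set Tx} {o : Out}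
    (ho : o ∈ G.backing C A₁ t₁) {s : Tx} (hs : Sum.inl s ∈ G.past A₁ ∧ Sum.inl s ∈ G.past A₂) :
    o ∉ G.inputs s := fun hos =>
  h.left_notMem ((mem_backing.1 ho).2.2 s hs.1 hos ▸ hs.2)

theorem isLedger_of_exists_certifiesAt (h : G.MinimalFork x y A₁ A₂ t₁ t₂) (hG : G.WellFormed)
    {D : Set Tx} (hgen : G.genesis ∈ D) (horigin : ∀ t ∈ D, ∀ o ∈ G.inputs t, G.origin o ∈ D)
    (hcert : ∀ s ∈ D, s ≠ G.genesis → ∃ z, (z < x ∨ z < y) ∧ ∃ B, G.CertifiesAt z B s) :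
    G.IsLedger D where
  genesis_mem := hgen
  origin_mem := horigin
  not_sharesInput s hs t ht hst := by
    obtain ⟨z, hz, B, hB⟩ := hcert s hs (hst.ne_genesis hG)
    obtain ⟨z', hz', B', hB'⟩ := hcert t ht (hst.symm.ne_genesis hG)
    exact (h.compatible z z' hz hz').not_sharesInput hB hB' hst

theorem exists_certifiesAt (h : G.MinimalFork x y A₁ A₂ t₁ t₂) {s : Tx} (hs : s ∈ G.basis x A₁)
    (hg : s ≠ G.genesis) : ∃ z, (z < x ∨ z < y) ∧ ∃ B, G.CertifiesAt z B s := by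
  obtain ⟨z, hz, B, -, hB⟩ := exists_certifiesAt_of_mem_basis h.left.past_subset hs hg
  exact ⟨z, Or.inl hz, B, hB⟩

theorem isLedger_union (h : G.MinimalFork x y A₁ A₂ t₁ t₂) (hG : G.WellFormed) :
    G.IsLedger (G.basis x A₁ ∪ G.basis y A₂) := by
  refine h.isLedger_of_exists_certifiesAt hG (Or.inl (h.genesis_mem_basis hG)) ?_ ?_
  · rintro t (ht | ht) o ho
    · exact Or.inl (hG.origin_mem_stage ht ho)
    · exact Or.inr (hG.origin_mem_stage ht ho)
  · rintro s (hs | hs) hg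
    · exact h.exists_certifiesAt hs hg
    · obtain ⟨z, hz, hB⟩ := h.symm.exists_certifiesAt hs hg
      exact ⟨z, hz.symm, hB⟩

open Classical in
theorem sum_union_backing_le (h : G.MinimalFork x y A₁ A₂ t₁ t₂) (hG : G.WellFormed) :
    ∑ o ∈ G.backing (G.basis x A₁) A₁ t₁ ∪ G.backing (G.basis y A₂) A₂ t₂, (G.value o : ℝ) ≤
      G.totalMoney := by
  have hknown : ∀ s ∈ G.basis x A₁ ∪ G.basis y A₂,
      Sum.inl s ∈ G.past A₁ ∧ Sum.inl s ∈ G.past A₂ := by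
    rintro s (hs | hs)
    · exact h.mem_past_of_mem_basis hG hs
    · exact (h.symm.mem_past_of_mem_basis hG hs).symm
  rw [← (h.isLedger_union hG).sum_value_unspent hG]
  refine sum_value_mono (Finset.union_subset (fun o ho => ?_) fun o ho => ?_)
  · exact mem_unspent.2 ⟨Or.inl (mem_backing.1 ho).1,
      fun s hs => h.notMem_inputs_of_mem_backing ho (hknown s hs)⟩
  · exact mem_unspent.2 ⟨Or.inr (mem_backing.1 ho).1,
      fun s hs => h.symm.notMem_inputs_of_mem_backing ho (hknown s hs).symm⟩

open Classical in
theorem lt_sum_inter_backing (h : G.MinimalFork x y A₁ A₂ t₁ t₂) (hG : G.WellFormed) :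
    G.totalMoney / 3 <
      ∑ o ∈ G.backing (G.basis x A₁) A₁ t₁ ∩ G.backing (G.basis y A₂) A₂ t₂, (G.value o : ℝ) := by
  have hunion := h.sum_union_backing_le hG
  have hincl_excl := Finset.sum_union_inter (s₁ := G.backing (G.basis x A₁) A₁ t₁)
    (s₂ := G.backing (G.basis y A₂) A₂ t₂) (f := fun o => (G.value o : ℝ))
  linarith [h.left.certifies.lt_sum_backing, h.right.certifies.lt_sum_backing]

theorem delegate_mem_of_mem_backing (h : G.MinimalFork x y A₁ A₂ t₁ t₂) (hH : G.AcksChained Adv)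
    {C₁ C₂ : Set Tx} {o : Out} (ho₁ : o ∈ G.backing C₁ A₁ t₁) (ho₂ : o ∈ G.backing C₂ A₂ t₂) :
    G.delegate o ∈ Adv := by
  by_contra hv
  exact (hH.mem_past_or_mem_past_of_signs hv (mem_backing.1 ho₁).2.1 (mem_backing.1 ho₂).2.1).elim
    h.left_notMem h.right_notMem

theorem rank_lt (h : G.MinimalFork x y A₁ A₂ t₁ t₂) (hG : G.WellFormed) {d : Tx}
    (hd : d ∈ G.basis x A₁) (k : ℕ) : toLex (G.time (Sum.inl d), k) < x :=
  Prod.Lex.left _ _ <| hG.time_lt_of_mem_past h.left.past_subset (h.mem_past_of_mem_basis hG hd).1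

theorem mem_past_of_mem_stage_issuedBy (h : G.MinimalFork x y A₁ A₂ t₁ t₂) (hG : G.WellFormed)
    {d : Tx} (hd : d ∈ G.basis x A₁) {n : ℕ} {s : Tx}
    (hs : s ∈ G.stage n (G.issuedBy (G.time (Sum.inl d)))) (hg : s ≠ G.genesis) :
    Sum.inl s ∈ G.past A₁ := by
  obtain ⟨k, -, B, hB, hc⟩ := (hG.refClosed_issuedBy _).exists_certifiesAt subset_rfl hs hg
  have hdg : d ≠ G.genesis := by
    rintro rfl
    exact (hG.time_lt_of_mem_past hB hc.certifies.mem_past).not_ge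
      (hG.time_le_of_reach (hG.reach_genesis _))
  obtain ⟨z, hz, B', hB', hc'⟩ := exists_certifiesAt_of_mem_basis h.left.past_subset hd hdg
  exact hB' <| (h.compatible _ z (Or.inl (h.rank_lt hG hd k)) (Or.inl hz) hc hc').resolve_right
    fun hm => (hG.time_lt_of_mem_past hB hm).false

theorem isLedger_inter_union_stage (h : G.MinimalFork x y A₁ A₂ t₁ t₂) (hG : G.WellFormed)
    {d : Tx} (hd : d ∈ G.basis x A₁) (n : ℕ) :
    G.IsLedger (G.basis x A₁ ∩ G.basis y A₂ ∪ G.stage n (G.issuedBy (G.time (Sum.inl d)))) := by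
  refine h.isLedger_of_exists_certifiesAt hG
    (Or.inl ⟨h.genesis_mem_basis hG, h.symm.genesis_mem_basis hG⟩) ?_ ?_
  · rintro t (ht | ht) o ho
    · exact Or.inl ⟨hG.origin_mem_stage ht.1 ho, hG.origin_mem_stage ht.2 ho⟩
    · exact Or.inr (hG.origin_mem_stage ht ho)
  · rintro s (hs | hs) hg
    · exact h.exists_certifiesAt hs.1 hg
    · obtain ⟨k, -, B, -, hB⟩ := (hG.refClosed_issuedBy _).exists_certifiesAt subset_rfl hs hg
      exact ⟨_, Or.inl (h.rank_lt hG hd k), B, hB⟩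

open Classical in
theorem inter_backing_subset_unspent (h : G.MinimalFork x y A₁ A₂ t₁ t₂) (hG : G.WellFormed)
    {d : Tx} (hd : d ∈ G.basis x A₁ ∩ G.basis y A₂) (n : ℕ) :
    G.backing (G.basis x A₁) A₁ t₁ ∩ G.backing (G.basis y A₂) A₂ t₂ ⊆
      G.unspent (G.basis x A₁ ∩ G.basis y A₂ ∪ G.stage n (G.issuedBy (G.time (Sum.inl d)))) := by
  intro o ho
  obtain ⟨ho₁, ho₂⟩ := Finset.mem_inter.1 ho
  refine mem_unspent.2 ⟨Or.inl ⟨(mem_backing.1 ho₁).1, (mem_backing.1 ho₂).1⟩, ?_⟩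
  rintro s (hs | hs) hos
  · exact h.notMem_inputs_of_mem_backing ho₁ (h.mem_past_of_mem_basis hG hs.1) hos
  · have hg := hG.ne_genesis_of_mem_inputs hos
    exact h.notMem_inputs_of_mem_backing ho₁ ⟨h.mem_past_of_mem_stage_issuedBy hG hd.1 hs hg,
      h.symm.mem_past_of_mem_stage_issuedBy hG hd.2 hs hg⟩ hos

open Classical in
theorem exists_sum_inter_backing_le (h : G.MinimalFork x y A₁ A₂ t₁ t₂) (hG : G.WellFormed)
    (hH : G.AcksChained Adv) (r : SpendRule) : ∃ τ,
    ∑ o ∈ G.backing (G.basis x A₁) A₁ t₁ ∩ G.backing (G.basis y A₂) A₂ t₂, (G.value o : ℝ) ≤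
      G.adversaryStake r Adv τ := by
  obtain ⟨d, hd, hlast⟩ := (Set.toFinite (G.basis x A₁ ∩ G.basis y A₂)).exists_maximalFor
    (fun t => G.time (Sum.inl t)) _ ⟨_, h.genesis_mem_basis hG, h.symm.genesis_mem_basis hG⟩
  obtain ⟨n, hn⟩ := exists_subset_stage
    (C := {s | G.Confirmed r (G.issuedBy (G.time (Sum.inl d))) s}) fun _ hs => hs.exists_mem_stage
  refine ⟨G.time (Sum.inl d), le_trans (sum_value_mono fun o ho => ?_)
    ((h.isLedger_inter_union_stage hG hd.1 n).sum_value_unspent_adversary_le hG ?_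
      fun t ht => Or.inr (hn ht))⟩
  · obtain ⟨ho₁, ho₂⟩ := Finset.mem_inter.1 ho
    exact Finset.mem_filter.2 ⟨h.inter_backing_subset_unspent hG hd n ho,
      h.delegate_mem_of_mem_backing hH ho₁ ho₂⟩
  · rintro t (ht | ht)
    · exact (le_total _ _).elim id (hlast ht)
    · exact (hG.refClosed_issuedBy _).mem_of_mem_stage ht

end MinimalFork

theorem compatible_of_adversaryStake_lt (hG : G.WellFormed) (hH : G.AcksChained Adv)
    (hStake : ∀ τ, G.adversaryStake r Adv τ < G.totalMoney / 3) (x y : ℕ ×ₗ ℕ) :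
    G.Compatible x y := by
  refine pair_induction (fun x y ih ihx ihy A₁ A₂ t₁ t₂ h₁ h₂ => ?_) x y
  by_contra! hfork
  have h : G.MinimalFork x y A₁ A₂ t₁ t₂ := ⟨h₁, h₂, hfork.1, hfork.2, ih, ihx, ihy⟩
  obtain ⟨τ, hτ⟩ := h.exists_sum_inter_backing_le hG hH r
  exact (hStake τ).not_gt ((h.lt_sum_inter_backing hG).trans_le hτ)

theorem Confirmed.of_depends (hG : G.WellFormed) {P : Set (Tx ⊕ Ack)} {s t : Tx}
    (ht : G.Confirmed r P t) (h : G.Depends t s) : G.Confirmed r P s := by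
  induction h with
  | refl => exact ht
  | tail _ h ih =>
    obtain ⟨o, ho, rfl⟩ := h
    cases ih with
    | genesis => exact absurd rfl (hG.ne_genesis_of_mem_inputs ho)
    | step _ _ _ _ _ h_origin => exact h_origin o ho

theorem Conflicts.exists_sharesInput {t₁ t₂ : Tx} (h : G.Conflicts t₁ t₂) :
    ∃ s₁ s₂, G.Depends t₁ s₁ ∧ G.Depends t₂ s₂ ∧ G.SharesInput s₁ s₂ := by
  induction h with
  | spend h => exact ⟨_, _, .refl, .refl, h⟩
  | depends _ h₁ h₂ ih =>
    obtain ⟨s₁, s₂, hs₁, hs₂, hs⟩ := ih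
    exact ⟨s₁, s₂, h₁.trans hs₁, h₂.trans hs₂, hs⟩

end Dag

end ABC

theorem mainTheorem1_general {Key Out Tx Ack : Type*} [Fintype Out] [Fintype Tx] [Fintype Ack]
    (G : ABC.Dag Key Out Tx Ack) (Adv : Set Key) (r : ABC.Dag.SpendRule)
    (hG : G.WellFormed) (hChained : G.AcksChained Adv)
    (hStake : ∀ τ : ℕ, G.adversaryStake r Adv τ < G.totalMoney / 3) :
    ¬ ∃ t₁ t₂ : Tx, G.Confirmed r Set.univ t₁ ∧ G.Confirmed r Set.univ t₂ ∧
      G.Conflicts t₁ t₂ := by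
  rintro ⟨t₁, t₂, h₁, h₂, hconflict⟩
  obtain ⟨s₁, s₂, hd₁, hd₂, hs⟩ := hconflict.exists_sharesInput
  obtain ⟨x, A₁, hA₁⟩ := (h₁.of_depends hG hd₁).exists_certifiesAt (hs.ne_genesis hG)
  obtain ⟨y, A₂, hA₂⟩ := (h₂.of_depends hG hd₂).exists_certifiesAt (hs.symm.ne_genesis hG)
  exact (ABC.Dag.compatible_of_adversaryStake_lt hG hChained hStake x y).not_sharesInput hA₁ hA₂ hs

theorem mainTheorem1 {Key Out Tx Ack : Type*} [Fintype Out] [Fintype Tx] [Fintype Ack]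
    (G : ABC.Dag Key Out Tx Ack) (Adv : Set Key) (r : ABC.Dag.SpendRule)
    (hG : G.WellFormed) (hHonest : G.HonestFollow Adv)
    (hStake : ∀ τ : ℕ, G.adversaryStake r Adv τ < G.totalMoney / 3) :
    ¬ ∃ t₁ t₂ : Tx, G.Confirmed r Set.univ t₁ ∧ G.Confirmed r Set.univ t₂ ∧
      G.Conflicts t₁ t₂ :=
  mainTheorem1_general G Adv r hG (hHonest.acksChained hG) hStake
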